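/- All graphs are simple and plane, with outer cycle written $C\colon v_1v_2\cdots v_kv_1$ ($k\ge 3$); the vertices not on $C$ are called inner vertices. A wheel is a graph consisting of such a cycle $C$ and one inner vertex joined to all vertices of $C$. Multi-wheels are the graphs obtained as follows. Every wheel is a multi-wheel. If $G$ is a multi-wheel with outer cycle $v_1v_2\cdots v_kv_1$ and $v_i u v_{i+1}$ ($2\le i\le k-1$) is a facial triangle of $G$ that does not contain $v_1$, where the edges $uv_i,uv_{i+1}$ lie in the interior of $C$, then the following graph is a multi-wheel: replace the edge $v_iv_{i+1}$ of the outer cycle by a path $v_iw_1\cdots w_jv_{i+1}$ with $j\ge 0$ new vertices $w_1,\dots,w_j$, and add a new inner vertex $w$ joined to $u,v_i,w_1,\dots,w_j,v_{i+1}$; the outer cycle of the new graph is $v_1\cdots v_iw_1\cdots w_jv_{i+1}\cdots v_kv_1$, with the same first vertex $v_1$. A separating triangle is a triangle whose three vertices leave a disconnected graph when they are deleted. Let $G$ be a multi-wheel with outer cycle $C\colon v_1v_2\cdots v_kv_1$. Assume that $G$ has no separating triangle, that $G$ has at least two inner vertices, and that all inner vertices are joined to $v_2$. Then, for every orientation of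 $G$ and every $\phi\colon E(G)\to\mathbb Z_5$, the graph $G$ is $(\mathbb Z_5,3)$-extendable with respect to $\phi$ and the vertices $v_1,v_2,v_k$. That is: let colors $c(v_k),c(v_1),c(v_2)\in\mathbb Z_5$ be given that satisfy the coloring condition below on the two edges $v_kv_1$ and $v_1v_2$, and let $F_v\subseteq\mathbb Z_5$ with $|F_v|\le 2$ be given for each $v\in V(C)\setminus\{v_1,v_2,v_k\}$. Then $c$ extends to a map $c\colon V(G)\to\mathbb Z_5$ such that $c(y)-c(x)\ne\phi(xy)$ for every edge $xy$ directed from $x$ towards $y$, and $c(v)\notin F_v$ for every $v\in V(C)\setminus\{v_1,v_2,v_k\}$. -/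

import Mathlib

/-- A finite plane near-triangulation together with its outer cycle, recorded combinatorially:
its vertex set, its edges (a simple graph on the ambient label type `V`), its outer cycle
`v₁ v₂ … v_k v₁` as the list `[v₁, v₂, …, v_k]`, and the vertex sets of its bounded facial
triangles.  This is only a record of data; the graphs considered below are those built from
wheels by the operations below, which determine all four components. -/
structure PlaneGraph (V : Type*) where
  /-- the vertices -/
  verts : Set V
  /-- the edges -/
  graph : SimpleGraph V
  /-- the outer cycle, starting at the major vertex `v₁` -/
  outer : List V
  /-- the vertex sets of the bounded faces -/
  faces : Set (Set V)

/-- `x, y` are consecutive entries (in this order) of the list `L`. -/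
def Consecutive {V : Type*} (L : List V) (x y : V) : Prop := [x, y] <:+: L

/-- The graph formed by the path that runs through the entries of a list in order. -/
def pathOf {V : Type*} (L : List V) : SimpleGraph V :=
  SimpleGraph.fromRel (Consecutive L)

/-- The star that joins `w` to all elements of `S`. -/
def starOf {V : Type*} (w : V) (S : Set V) : SimpleGraph V :=
  SimpleGraph.fromRel fun x y => x = w ∧ y ∈ S

/-- The triangles spanned by `w` and two consecutive entries of `L`. -/
def fanFaces {V : Type*} (w : V) (L : List V) : Set (Set V) :=
  {T | ∃ x y, Consecutive L x y ∧ T = {w, x, y}}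

namespace PlaneGraph

/-- The wheel with outer cycle `C` and hub `h`: the hub is joined to all vertices of the cycle.
(`C ++ C.take 1` is the closed walk `v₁ v₂ … v_k v₁`.) -/
def wheel {V : Type*} (h : V) (C : List V) : PlaneGraph V where
  verts := {x | x = h ∨ x ∈ C}
  graph := pathOf (C ++ C.take 1) ⊔ starOf h {x | x ∈ C}
  outer := C
  faces := fanFaces h (C ++ C.take 1)

/-- Inserting a wheel into the triangle `a u b`, where `a b` is an edge of the outer cycle
`l ++ [a, b] ++ r`: the edge `a b` is replaced by the path `a w₁ … w_j b` with `p = [w₁, …, w_j]`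
(for `j = 0` this is the edge `a b` itself), and a new vertex `w` is joined to `u` and to all
vertices of this path. -/
def insertWheel {V : Type*} (G : PlaneGraph V) (l r : List V) (a b u w : V) (p : List V) :
    PlaneGraph V where
  verts := G.verts ∪ {x | x = w ∨ x ∈ p}
  graph := G.graph.deleteEdges {s(a, b)} ⊔ pathOf (a :: p ++ [b])
    ⊔ starOf w {x | x = u ∨ x ∈ a :: p ++ [b]}
  outer := l ++ (a :: p ++ [b]) ++ r
  faces := (G.faces \ {{a, b, u}}) ∪ {{w, u, a}, {w, u, b}} ∪ fanFaces w (a :: p ++ [b])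

/-- Multi-wheels: all wheels, and all graphs obtained from a multi-wheel by inserting a wheel into
a facial triangle `a u b` that avoids the major vertex `v₁`, where `a b` is an edge of the outer
cycle and the edges `u a`, `u b` lie in its interior.  The condition `l ≠ []` says that `a` (and
hence `b`) is not `v₁`; as multi-wheels have no chords, `u` is an inner vertex. -/
inductive IsMultiWheel {V : Type*} : PlaneGraph V → Prop
  | wheel (h : V) (C : List V) (hlen : 3 ≤ C.length) (hnodup : (h :: C).Nodup) :
      IsMultiWheel (PlaneGraph.wheel h C)
  | insert (G : PlaneGraph V) (l r : List V) (a b u w : V) (p : List V)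
      (hG : IsMultiWheel G)
      (houter : G.outer = l ++ [a, b] ++ r) (hl : l ≠ [])
      (hu : u ∈ G.verts) (hu' : u ∉ G.outer)
      (hface : {a, b, u} ∈ G.faces)
      (hnew : ∀ x ∈ w :: p, x ∉ G.verts) (hnodup : (w :: p).Nodup) :
      IsMultiWheel (G.insertWheel l r a b u w p)

/-- The inner vertices: the vertices that are not on the outer cycle. -/
def inner {V : Type*} (G : PlaneGraph V) : Set V := {x ∈ G.verts | x ∉ G.outer}

/-- A separating triangle: three pairwise adjacent vertices whose deletion leaves a disconnected
graph. -/
def HasSeparatingTriangle {V : Type*} (G : PlaneGraph V) : Prop :=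
  ∃ x y z : V, G.graph.Adj x y ∧ G.graph.Adj y z ∧ G.graph.Adj x z ∧
    ¬ (G.graph.induce (G.verts \ {x, y, z})).Preconnected

end PlaneGraph

/-- An orientation of a simple graph: each edge is directed towards exactly one of its ends;
`dir x y` means that `xy` is an edge directed from `x` towards `y`. -/
structure EdgeOrientation {V : Type*} (G : SimpleGraph V) where
  /-- the direction relation -/
  dir : V → V → Prop
  adj_of_dir : ∀ x y, dir x y → G.Adj x y
  dir_or_dir : ∀ x y, G.Adj x y → dir x y ∨ dir y x
  asymm : ∀ x y, dir x y → ¬ dir y x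

/-- `c` is a `(ℤ₅, φ)`-coloring: `c y - c x ≠ φ(xy)` for each edge `xy` directed towards `y`.
Only the values of `φ` on edges matter. -/
def IsGroupColoring {V : Type*} {G : SimpleGraph V} (D : EdgeOrientation G)
    (φ : Sym2 V → ZMod 5) (c : V → ZMod 5) : Prop :=
  ∀ x y, D.dir x y → c y - c x ≠ φ s(x, y)

open Classical in
/-- The color at the neighbor `u` of `v` that is not allowed if `v` has color `α`. -/
noncomputable def tau {V : Type*} {G : SimpleGraph V} (D : EdgeOrientation G)
    (φ : Sym2 V → ZMod 5) (v : V) (α : ZMod 5) (u : V) : ZMod 5 :=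
  if D.dir v u then α + φ s(v, u) else α - φ s(v, u)

/-- `(ℤ₅, 3)`-extendability with respect to `φ` and the vertices `v₁, v₂, v_k`.  Here `c₀` supplies
the precolors of `v_k, v₁, v₂` (its other values are irrelevant), and `F` is the assignment of
forbidden colors. -/
def PlaneGraph.IsThreeExtendable {V : Type*} (G : PlaneGraph V) (D : EdgeOrientation G.graph)
    (φ : Sym2 V → ZMod 5) (v₁ v₂ vk : V) : Prop :=
  ∀ (c₀ : V → ZMod 5) (F : V → Finset (ZMod 5)),
    c₀ vk ≠ tau D φ v₁ (c₀ v₁) vk →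
    c₀ v₂ ≠ tau D φ v₁ (c₀ v₁) v₂ →
    (∀ x ∈ G.outer, x ≠ v₁ → x ≠ v₂ → x ≠ vk → (F x).card ≤ 2) →
    (∀ x, ¬ (x ∈ G.outer ∧ x ≠ v₁ ∧ x ≠ v₂ ∧ x ≠ vk) → F x = ∅) →
    ∃ c : V → ZMod 5, c v₁ = c₀ v₁ ∧ c v₂ = c₀ v₂ ∧ c vk = c₀ vk ∧
      IsGroupColoring D φ c ∧
      ∀ x ∈ G.outer, x ≠ v₁ → x ≠ v₂ → x ≠ vk → c x ∉ F x

/-! An inserted hub is adjacent only to `u` and to the new path. Being joined to `v₂`, it must have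
been inserted at an outer edge containing `v₂` but not `v₁`, that is, at the edge `v₂b` following
`v₂`. So all wheels are stacked at `v₂`, each inserted into the triangle spanned by `v₂`, `b` and
the previous hub.

Now omit the edge `v₂b`. By induction on the number of wheels, the precoloring extends to the
remaining graph with at least two possible colors at the last hub: three colored neighbors leave two
colors for the hub, and its fan is then colored greedily towards `v₂`, each vertex meeting at most 2
+ 1 + 1 < 5 forbidden colors. This is `IsApex`, obtained in `IsMultiWheel.exists_isApex`.

For the whole graph, take off the last wheel, with hub `w` inserted at the old hub `u`. Without
separating triangles it has a new outer vertex `d` next to `v₂`, and the edge `v₂d` becomes a third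
forbidden color at `d`. By `exists_fanGood`, one of two colorings that differ at `u` extends. If a
fan fails for every admissible hub color, then the three colors forbidden at `w` are exactly the hub
colors that only repeat a forbidden color of `d`. If this happened for both colorings,
`eq_of_not_fanGood` would give `b` the same color in both, and then two different colors of `u`
cannot yield the same three-element set. -/

/-- The vertices of `q` can be colored one after the other, starting next to `b` of color `β`, so
that each one avoids its forbidden colors and is compatible with its predecessor and with the hub
`w` of color `γ`. -/
def FanGood {V : Type*} (σ : V → V → ZMod 5) (F : V → Finset (ZMod 5)) (w : V) (γ : ZMod 5) :
    V → ZMod 5 → List V → Prop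
  | _, _, [] => True
  | b, β, x :: q =>
    ∃ e, e ∉ F x ∧ e ≠ γ + σ w x ∧ e ≠ β + σ b x ∧ FanGood σ F w γ x e q

theorem exists_notMem_of_card_lt_five {S : Finset (ZMod 5)} (hS : S.card < 5) : ∃ e, e ∉ S := by
  by_contra! h
  have : S = Finset.univ := Finset.eq_univ_iff_forall.2 h
  rw [this, Finset.card_univ, ZMod.card] at hS
  omega

/-! ### Greedy coloring of fans from lists of forbidden colors. -/

section Fan

variable {V : Type*} {σ : V → V → ZMod 5} {F : V → Finset (ZMod 5)} {w : V} {γ : ZMod 5}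

theorem exists_fan_color {S : Finset (ZMod 5)} (hS : S.card ≤ 2) (x y : ZMod 5) :
    ∃ e, e ∉ S ∧ e ≠ x ∧ e ≠ y := by
  have h : (insert x (insert y S)).card < 5 := by
    have h₁ := Finset.card_insert_le x (insert y S)
    have h₂ := Finset.card_insert_le y S
    omega
  obtain ⟨e, he⟩ := exists_notMem_of_card_lt_five h
  simp only [Finset.mem_insert, not_or] at he
  exact ⟨e, he.2.2, he.1, he.2.1⟩

theorem fanGood_of_card_le {q : List V} (hq : ∀ x ∈ q, (F x).card ≤ 2) (b : V) (β : ZMod 5) :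
    FanGood σ F w γ b β q := by
  induction q generalizing b β with
  | nil => trivial
  | cons x q ih =>
    obtain ⟨e, h₁, h₂, h₃⟩ := exists_fan_color (hq x (by simp)) (γ + σ w x) (β + σ b x)
    exact ⟨e, h₁, h₂, h₃, ih (fun y hy => hq y (by simp [hy])) _ _⟩

/-- If the coloring of a fan fails, then the hub color matters at the last vertex. -/
theorem notMem_of_not_fanGood {q : List V} {z : V} (hq : ∀ x ∈ q, (F x).card ≤ 2)
    (hz : (F z).card ≤ 3) {b : V} {β : ZMod 5} (h : ¬ FanGood σ F w γ b β (q ++ [z])) :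
    γ + σ w z ∉ F z := by
  induction q generalizing b β with
  | nil =>
    intro hmem
    -- If the color excluded by the hub already lies in `F z`, only 3 + 1 colors are excluded at
    -- `z`.
    obtain ⟨e, he⟩ := exists_notMem_of_card_lt_five (S := insert (β + σ b z) (F z)) (by
      have := Finset.card_insert_le (β + σ b z) (F z)
      omega)
    simp only [Finset.mem_insert, not_or] at he
    exact h ⟨e, he.2, fun h' => he.2 (h' ▸ hmem), he.1, trivial⟩
  | cons x q ih =>
    obtain ⟨e, h₁, h₂, h₃⟩ := exists_fan_color (hq x (by simp)) (γ + σ w x) (β + σ b x)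
    exact ih (fun y hy => hq y (by simp [hy])) (fun h' => h ⟨e, h₁, h₂, h₃, h'⟩)

/-- For a given hub color, the coloring of a fan fails for at most one color of the first
vertex. -/
theorem eq_of_not_fanGood {q : List V} {z : V} (hq : ∀ x ∈ q, (F x).card ≤ 2)
    (hz : (F z).card ≤ 3) {b : V} {β β' : ZMod 5} (h : ¬ FanGood σ F w γ b β (q ++ [z]))
    (h' : ¬ FanGood σ F w γ b β' (q ++ [z])) : β = β' := by
  induction q generalizing b β β' with
  | nil =>
    by_contra hne
    obtain ⟨e, he⟩ := exists_notMem_of_card_lt_five (S := insert (γ + σ w z) (F z)) (by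
      have := Finset.card_insert_le (γ + σ w z) (F z)
      omega)
    simp only [Finset.mem_insert, not_or] at he
    by_cases heq : e = β + σ b z
    · exact h' ⟨e, he.2, he.1, fun h'' => hne (add_right_cancel (heq.symm.trans h'')), trivial⟩
    · exact h ⟨e, he.2, he.1, heq, trivial⟩
  | cons x q ih =>
    by_contra hne
    -- A color of `x` allowed by its list and the hub is excluded by at most one of `β ≠ β'`, so all
    -- such colors lead to failure further on. There are at least two of them, contradicting the
    -- induction hypothesis.
    have key : ∀ e, e ∉ F x → e ≠ γ + σ w x → ¬ FanGood σ F w γ x e (q ++ [z]) := by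
      intro e he₁ he₂ hgood
      by_cases heq : e = β + σ b x
      · exact h' ⟨e, he₁, he₂, fun h'' => hne (add_right_cancel (heq.symm.trans h'')), hgood⟩
      · exact h ⟨e, he₁, he₂, heq, hgood⟩
    -- The value `0` is a dummy.
    obtain ⟨e, h₁, h₂, -⟩ := exists_fan_color (hq x (by simp)) (γ + σ w x) 0
    obtain ⟨e', h₁', h₂', h₃⟩ := exists_fan_color (hq x (by simp)) (γ + σ w x) e
    exact h₃ (ih (fun y hy => hq y (by simp [hy])) (key e' h₁' h₂') (key e h₁ h₂))

/-- A good fan can be colored. -/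
theorem exists_coloring_of_fanGood {q : List V} {b : V} {c : V → ZMod 5}
    (hnodup : (b :: q).Nodup) (h : FanGood σ F w γ b (c b) q) :
    ∃ c' : V → ZMod 5, (∀ x, x ∉ q → c' x = c x) ∧
      (∀ x ∈ q, c' x ∉ F x ∧ c' x ≠ γ + σ w x) ∧
      (b :: q).IsChain fun x y => c' y ≠ c' x + σ x y := by
  classical
  induction q generalizing b c with
  | nil => exact ⟨c, by simp, by simp, by simp⟩
  | cons x q ih =>
    obtain ⟨e, h₁, h₂, h₃, h₄⟩ := h
    rw [List.nodup_cons] at hnodup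
    have hx : x ∉ q := (List.nodup_cons.1 hnodup.2).1
    have hb : b ≠ x ∧ b ∉ q := by simpa using hnodup.1
    obtain ⟨c', g₁, g₂, g₃⟩ := ih (b := x) (c := Function.update c x e) hnodup.2 (by simpa using h₄)
    have hcx : c' x = e := by rw [g₁ x hx]; simp
    have hcb : c' b = c b := by rw [g₁ b hb.2]; simp [hb.1]
    refine ⟨c', ?_, ?_, ?_⟩
    · intro y hy
      simp only [List.mem_cons, not_or] at hy
      rw [g₁ y hy.2]
      simp [hy.1]
    · intro y hy
      rcases List.mem_cons.1 hy with rfl | hy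
      · rw [hcx]; exact ⟨h₁, h₂⟩
      · exact g₂ y hy
    · rw [List.isChain_cons_cons]
      exact ⟨by rw [hcx, hcb]; exact h₃, g₃⟩

/-- If the hub of a fan is to avoid `x`, `y`, `β + s`, or else `x`, `y'`, `β' + s`, where `β`, `β'`
are colors of the first vertex and `y ≠ y'`, then in one of the two cases there is a hub color for
which the fan can be colored. -/
theorem exists_fanGood {q : List V} {z : V} (hq : ∀ x ∈ q, (F x).card ≤ 2)
    (hz : (F z).card ≤ 3) {b : V} {x y y' s β β' : ZMod 5} (hy : y ≠ y') :
    (∃ γ, γ ≠ x ∧ γ ≠ y ∧ γ ≠ β + s ∧ FanGood σ F w γ b β (q ++ [z])) ∨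
    (∃ γ, γ ≠ x ∧ γ ≠ y' ∧ γ ≠ β' + s ∧ FanGood σ F w γ b β' (q ++ [z])) := by
  by_contra! hcon
  obtain ⟨h, h'⟩ := hcon
  have hz3 : (F z).card = 3 := by
    by_contra hne
    obtain ⟨γ, h₁, h₂, h₃⟩ := exists_fan_color (S := {x}) (by simp) y (β + s)
    refine h γ (by simpa using h₁) h₂ h₃ (fanGood_of_card_le (fun v hv => ?_) _ _)
    rcases List.mem_append.1 hv with hv | hv
    · exact hq v hv
    · rw [List.mem_singleton.1 hv]; omega
  -- The hub colors that exclude at `z` a color already in `F z`. None of them can fail, so `B` lies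
  -- in the forbidden triple, and both have at most, hence exactly, three elements.
  let B : Finset (ZMod 5) := (F z).image (· - σ w z)
  have hB : B.card = 3 := by
    rw [Finset.card_image_of_injective _ (sub_left_injective), hz3]
  have hB_eq : ∀ y β, (∀ γ, γ ≠ x → γ ≠ y → γ ≠ β + s → ¬ FanGood σ F w γ b β (q ++ [z])) →
      B = {x, y, β + s} := by
    intro y β h
    refine Finset.eq_of_subset_of_card_le (fun γ hγ => ?_) (hB ▸ Finset.card_le_three)
    by_contra hn
    simp only [Finset.mem_insert, Finset.mem_singleton, not_or] at hn
    obtain ⟨δ, hδ, rfl⟩ := Finset.mem_image.1 hγ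
    exact notMem_of_not_fanGood hq hz (h _ hn.1 hn.2.1 hn.2.2) (by simpa using hδ)
  have e := hB_eq y β h
  have e' := hB_eq y' β' h'
  have hβ : β = β' := by
    obtain ⟨γ, hγ⟩ := exists_notMem_of_card_lt_five (S := B) (by omega)
    have g := e ▸ hγ
    have g' := e' ▸ hγ
    simp only [Finset.mem_insert, Finset.mem_singleton, not_or] at g g'
    exact eq_of_not_fanGood hq hz (h γ g.1 g.2.1 g.2.2) (h' γ g'.1 g'.2.1 g'.2.2)
  -- Since `y ≠ y'` and `β = β'`, this makes `y` equal to `x` or `β + s`, so the triple `{x, y, β +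
  -- s}` degenerates.
  have hmem : y ∈ ({x, y', β' + s} : Finset (ZMod 5)) := by rw [← e', e]; simp
  simp only [Finset.mem_insert, Finset.mem_singleton, hy, false_or, ← hβ] at hmem
  have hle : B.card ≤ 2 := by
    rw [e]
    rcases hmem with rfl | rfl
    · simpa using Finset.card_le_two
    · rw [Finset.pair_eq_singleton]; exact Finset.card_le_two
  omega

end Fan

/-! ### Consecutive entries and adjacency in paths and stars. -/

theorem rel_of_consecutive {V : Type*} {R : V → V → Prop} {L : List V} (h : L.IsChain R) {x y : V}
    (hxy : Consecutive L x y) : R x y := by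
  simpa using h.infix hxy

theorem Consecutive.mem {V : Type*} {L : List V} {x y : V} (h : Consecutive L x y) :
    x ∈ L ∧ y ∈ L :=
  ⟨h.subset (by simp), h.subset (by simp)⟩

theorem consecutive_cons_cons {V : Type*} {L : List V} {x y a b : V} :
    Consecutive (a :: b :: L) x y ↔ (x = a ∧ y = b) ∨ Consecutive (b :: L) x y := by
  unfold Consecutive
  rw [List.infix_cons_iff]
  simp

theorem pathOf_adj {V : Type*} {L : List V} {x y : V} :
    (pathOf L).Adj x y ↔ x ≠ y ∧ (Consecutive L x y ∨ Consecutive L y x) :=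
  SimpleGraph.fromRel_adj _ _ _

theorem starOf_adj {V : Type*} {w : V} {S : Set V} {x y : V} :
    (starOf w S).Adj x y ↔ x ≠ y ∧ ((x = w ∧ y ∈ S) ∨ (y = w ∧ x ∈ S)) :=
  SimpleGraph.fromRel_adj _ _ _

/-! ### Well-formedness of multi-wheels and the position of the last wheel. -/

namespace PlaneGraph

variable {V : Type*}

/-- The edges and faces of a plane graph are spanned by its vertices, and its outer cycle is a
list of distinct vertices. -/
structure IsProper (G : PlaneGraph V) : Prop where
  nodup : G.outer.Nodup
  outer_mem : ∀ x ∈ G.outer, x ∈ G.verts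
  adj_mem : ∀ x y, G.graph.Adj x y → x ∈ G.verts
  face_mem : ∀ T ∈ G.faces, ∀ x ∈ T, x ∈ G.verts

theorem insertWheel_adj {G : PlaneGraph V} {l r : List V} {a b u w : V} {p : List V} {x y : V} :
    (G.insertWheel l r a b u w p).graph.Adj x y ↔
      (G.graph.Adj x y ∧ s(x, y) ≠ s(a, b)) ∨
      (x ≠ y ∧ (Consecutive (a :: p ++ [b]) x y ∨ Consecutive (a :: p ++ [b]) y x)) ∨
      (x ≠ y ∧ ((x = w ∧ (y = u ∨ y ∈ a :: p ++ [b])) ∨ (y = w ∧ (x = u ∨ x ∈ a :: p ++ [b])))) := by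
  simp only [insertWheel, SimpleGraph.sup_adj, SimpleGraph.deleteEdges_adj, Set.mem_singleton_iff,
    pathOf_adj, starOf_adj, Set.mem_ofPred_eq, or_assoc, ne_eq]

theorem wheel_adj {h : V} {C : List V} {x y : V} :
    (wheel h C).graph.Adj x y ↔
      (x ≠ y ∧ (Consecutive (C ++ C.take 1) x y ∨ Consecutive (C ++ C.take 1) y x)) ∨
      (x ≠ y ∧ ((x = h ∧ y ∈ C) ∨ (y = h ∧ x ∈ C))) := by
  simp only [wheel, SimpleGraph.sup_adj, pathOf_adj, starOf_adj, Set.mem_ofPred_eq]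

theorem isProper_wheel {h : V} {C : List V} (hnodup : (h :: C).Nodup) : (wheel h C).IsProper := by
  have hmem : ∀ x ∈ C ++ C.take 1, x ∈ C := by
    intro x hx
    rcases List.mem_append.1 hx with hx | hx
    · exact hx
    · exact List.mem_of_mem_take hx
  refine ⟨(List.nodup_cons.1 hnodup).2, fun x hx => Or.inr hx, fun x y hxy => ?_, ?_⟩
  · rcases wheel_adj.1 hxy with ⟨-, h | h⟩ | ⟨-, h | h⟩
    · exact Or.inr (hmem _ h.mem.1)
    · exact Or.inr (hmem _ h.mem.2)
    · exact Or.inl h.1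
    · exact Or.inr h.2
  · rintro T ⟨x, y, hxy, rfl⟩ z (rfl | rfl | rfl)
    · exact Or.inl rfl
    · exact Or.inr (hmem _ hxy.mem.1)
    · exact Or.inr (hmem _ hxy.mem.2)

theorem IsProper.isProper_insertWheel {G : PlaneGraph V} (hG : G.IsProper) {l r : List V} {a b u w : V}
    {p : List V} (houter : G.outer = l ++ [a, b] ++ r) (hu : u ∈ G.verts)
    (hnew : ∀ x ∈ w :: p, x ∉ G.verts) (hnodup : (w :: p).Nodup) :
    (G.insertWheel l r a b u w p).IsProper := by
  have ha : a ∈ G.verts := hG.outer_mem a (by simp [houter])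
  have hb : b ∈ G.verts := hG.outer_mem b (by simp [houter])
  have hpath : ∀ x ∈ a :: p ++ [b], x ∈ (G.insertWheel l r a b u w p).verts := by
    intro x hx
    simp only [List.cons_append, List.mem_cons, List.mem_append, List.not_mem_nil, or_false] at hx
    rcases hx with rfl | hx | rfl
    · exact Or.inl ha
    · exact Or.inr (Or.inr hx)
    · exact Or.inl hb
  have hold : ∀ x ∈ G.outer, x ∉ p := fun x hx hxp =>
    hnew x (by simp [hxp]) (hG.outer_mem x hx)
  refine ⟨?_, ?_, ?_, ?_⟩
  · have h₁ := hG.nodup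
    have h₂ := (List.nodup_cons.1 hnodup).2
    have hperm : (l ++ (a :: p ++ [b]) ++ r).Perm (p ++ (l ++ [a, b] ++ r)) := by
      classical
      rw [List.perm_iff_count]
      intro x
      simp only [List.count_append, List.count_cons, List.count_nil]
      omega
    refine (hperm.nodup_iff).2 (List.nodup_append'.2 ⟨h₂, houter ▸ h₁, fun x hx hx' => ?_⟩)
    exact hold x (houter ▸ hx') hx
  · intro x hx
    rcases List.mem_append.1 hx with hx | hx
    · rcases List.mem_append.1 hx with hx | hx
      · exact Or.inl (hG.outer_mem x (by simp [houter, hx]))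
      · exact hpath x hx
    · exact Or.inl (hG.outer_mem x (by simp [houter, hx]))
  · intro x y hxy
    rcases insertWheel_adj.1 hxy with ⟨h, -⟩ | ⟨-, h | h⟩ | ⟨-, ⟨rfl, -⟩ | ⟨-, rfl | h⟩⟩
    · exact Or.inl (hG.adj_mem _ _ h)
    · exact hpath _ h.mem.1
    · exact hpath _ h.mem.2
    · exact Or.inr (Or.inl rfl)
    · exact Or.inl hu
    · exact hpath _ h
  · rintro T (⟨⟨hT, -⟩ | (rfl | rfl)⟩ | ⟨x, y, hxy, rfl⟩) z hz
    · exact Or.inl (hG.face_mem T hT z hz)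
    · rcases hz with rfl | rfl | rfl
      exacts [Or.inr (Or.inl rfl), Or.inl hu, Or.inl ha]
    · rcases hz with rfl | rfl | rfl
      exacts [Or.inr (Or.inl rfl), Or.inl hu, Or.inl hb]
    · rcases hz with rfl | rfl | rfl
      exacts [Or.inr (Or.inl rfl), hpath _ hxy.mem.1, hpath _ hxy.mem.2]

theorem IsMultiWheel.isProper {G : PlaneGraph V} (hG : G.IsMultiWheel) : G.IsProper := by
  induction hG with
  | wheel h C hlen hnodup => exact isProper_wheel hnodup
  | insert G l r a b u w p hG houter hl hu hu' hface hnew hnodup ih =>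
    exact ih.isProper_insertWheel houter hu hnew hnodup

/-- If all inner vertices are joined to `v₂`, then the last wheel was inserted next to `v₂`. -/
theorem IsProper.eq_of_insertWheel {G : PlaneGraph V} (hG : G.IsProper) {l r : List V}
    {a b u w : V} {p : List V} (houter : G.outer = l ++ [a, b] ++ r) (hl : l ≠ [])
    (hu' : u ∉ G.outer) (hnew : ∀ x ∈ w :: p, x ∉ G.verts) (hnodup : (w :: p).Nodup)
    {v₁ v₂ : V} {t : List V} (hout : (G.insertWheel l r a b u w p).outer = v₁ :: v₂ :: t)
    (hv₂ : ∀ x ∈ (G.insertWheel l r a b u w p).inner,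
      (G.insertWheel l r a b u w p).graph.Adj x v₂) :
    l = [v₁] ∧ a = v₂ ∧ t = p ++ b :: r ∧ G.outer = v₁ :: v₂ :: b :: r ∧
      ∀ x ∈ G.inner, G.graph.Adj x v₂ := by
  have hw : w ∉ G.verts := hnew w (by simp)
  have hwout : w ∉ (G.insertWheel l r a b u w p).outer := by
    intro h
    have hwG : w ∉ G.outer := fun h => hw (hG.outer_mem w h)
    simp only [houter, List.mem_append, List.mem_cons, not_or] at hwG
    simp only [insertWheel, List.mem_append, List.mem_cons] at h
    have := (List.nodup_cons.1 hnodup).1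
    tauto
  have hadj := hv₂ w ⟨Or.inr (Or.inl rfl), hwout⟩
  -- If `l` had a second entry, that entry would be `v₂`, which then lies off the new path and
  -- cannot be adjacent to `w`.
  have hpos : l = [v₁] ∧ a = v₂ := by
    match l, hl with
    | [x], _ =>
      simp only [insertWheel, List.cons_append, List.nil_append, List.cons.injEq] at hout
      exact ⟨by rw [hout.1], hout.2.1⟩
    | x :: y :: l, _ =>
      exfalso
      simp only [insertWheel, List.cons_append, List.cons.injEq] at hout
      obtain ⟨-, rfl, -⟩ := hout
      have hy : y ∈ G.outer := by simp [houter]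
      have hyv := hG.outer_mem y hy
      have hmem : y ∈ a :: p ++ [b] ∨ y = u ∨ y = w := by
        rcases insertWheel_adj.1 hadj with ⟨h, -⟩ | ⟨-, h | h⟩ | ⟨-, ⟨-, h | h⟩ | ⟨h, -⟩⟩
        · exact absurd (hG.adj_mem _ _ h) hw
        · exact Or.inl h.mem.2
        · exact Or.inl h.mem.1
        · exact Or.inr (Or.inl h)
        · exact Or.inl h
        · exact Or.inr (Or.inr h)
      have hnd := hG.nodup
      rw [houter] at hnd
      simp only [List.cons_append, List.nodup_cons, List.mem_append, List.mem_cons, not_or] at hnd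
      simp only [List.cons_append, List.mem_cons, List.mem_append, List.not_mem_nil,
        or_false] at hmem
      rcases hmem with (h | h | h) | h | h
      · exact hnd.2.1.1.2.1 h
      · exact hnew y (by simp [h]) hyv
      · exact hnd.2.1.1.2.2.1 h
      · exact hu' (h ▸ hy)
      · exact hw (h ▸ hyv)
  obtain ⟨rfl, rfl⟩ := hpos
  refine ⟨rfl, rfl, ?_, by simp [houter], ?_⟩
  · simp only [insertWheel, List.cons_append, List.nil_append, List.cons.injEq, true_and,
      List.append_assoc] at hout
    exact hout.symm
  · rintro x ⟨hx, hxo⟩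
    have ha : a ∈ G.outer := by simp [houter]
    have hb : b ∈ G.outer := by simp [houter]
    have hxa : x ≠ a := fun h => hxo (h ▸ ha)
    have hxw : x ≠ w := fun h => hw (h ▸ hx)
    have haw : a ≠ w := fun h => hw (h ▸ hG.outer_mem a ha)
    have hpath : x ∉ a :: p ++ [b] := by
      have hxp : x ∉ p := fun h => hnew x (by simp [h]) hx
      have hxb : x ≠ b := fun h => hxo (h ▸ hb)
      simp [hxa, hxp, hxb]
    have hxo' : x ∉ (G.insertWheel [v₁] r a b u w p).outer := by
      rw [houter] at hxo
      simp only [List.mem_append, not_or] at hxo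
      simp only [insertWheel, List.mem_append, not_or]
      exact ⟨⟨hxo.1.1, not_or.1 (mt List.mem_append.2 hpath)⟩, hxo.2⟩
    rcases insertWheel_adj.1 (hv₂ x ⟨Or.inl hx, hxo'⟩) with
      ⟨h, -⟩ | ⟨-, h | h⟩ | ⟨-, ⟨h, -⟩ | ⟨h, -⟩⟩
    · exact h
    · exact absurd h.mem.1 hpath
    · exact absurd h.mem.2 hpath
    · exact absurd h hxw
    · exact absurd h haw

end PlaneGraph

/-! ### Colorings without the outer edge next to `v₂`, and the case of a wheel. -/

namespace PlaneGraph

variable {V : Type*}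

/-- `c` is a coloring of `G` minus the edge `ab`, where `σ x y` is the shift along `xy`. -/
def IsColoringOff (G : PlaneGraph V) (σ : V → V → ZMod 5) (a b : V) (c : V → ZMod 5) : Prop :=
  ∀ x y, G.graph.Adj x y → s(x, y) ≠ s(a, b) → c y ≠ c x + σ x y

theorem ne_add_symm {σ : V → V → ZMod 5} (hσ : ∀ x y, σ y x = -σ x y) {c : V → ZMod 5} {x y : V}
    (h : c y ≠ c x + σ x y) : c x ≠ c y + σ y x := by
  rw [hσ x y]
  intro h'
  exact h (by rw [h']; ring)

/-- A coloring of `G` minus `ab` extends to the graph obtained by inserting a wheel, minus the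
first edge of the new path. -/
theorem IsProper.exists_extension {G : PlaneGraph V} (hG : G.IsProper) {l r : List V}
    {a b u w : V} {p : List V} (houter : G.outer = l ++ [a, b] ++ r) (hu : u ∈ G.verts)
    (hnew : ∀ x ∈ w :: p, x ∉ G.verts) (hnodup : (w :: p).Nodup)
    {σ : V → V → ZMod 5} (hσ : ∀ x y, σ y x = -σ x y) {F : V → Finset (ZMod 5)}
    {c : V → ZMod 5} (hc : G.IsColoringOff σ a b c) {γ : ZMod 5} (hγa : γ ≠ c a + σ a w)
    (hγu : γ ≠ c u + σ u w) (hγb : γ ≠ c b + σ b w)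
    (hfan : FanGood σ F w γ b (c b) p.reverse) {d : V} {t : List V} (hd : p ++ [b] = d :: t) :
    ∃ c' : V → ZMod 5, (∀ x ∈ G.verts, c' x = c x) ∧ c' w = γ ∧ (∀ x ∈ p, c' x ∉ F x) ∧
      (G.insertWheel l r a b u w p).IsColoringOff σ a d c' := by
  classical
  have ha : a ∈ G.verts := hG.outer_mem a (by simp [houter])
  have hb : b ∈ G.verts := hG.outer_mem b (by simp [houter])
  have hw : w ∉ G.verts := hnew w (by simp)
  have hwp := List.nodup_cons.1 hnodup
  have hp : ∀ x ∈ G.verts, x ∉ p := fun x hx hxp => hnew x (by simp [hxp]) hx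
  have hne : ∀ x ∈ G.verts, x ≠ w := fun x hx h => hw (h ▸ hx)
  -- Coloring starts at `b` and runs backwards, so the edge left unchecked is the one joining `a` to
  -- `d`. If `p` is empty then `d = b`, and `ab` simply remains omitted.
  obtain ⟨c', h₁, h₂, h₃⟩ := exists_coloring_of_fanGood (σ := σ) (F := F) (w := w) (γ := γ)
    (q := p.reverse) (b := b) (c := Function.update c w γ)
    (by simpa using ⟨hp b hb, hwp.2⟩) (by simpa [hne b hb] using hfan)
  simp only [List.mem_reverse] at h₁ h₂
  have hold : ∀ x ∈ G.verts, c' x = c x := fun x hx => by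
    rw [h₁ x (hp x hx)]; simp [hne x hx]
  have hcw : c' w = γ := by rw [h₁ w hwp.1]; simp
  have hchain : (d :: t).IsChain fun x y => c' y ≠ c' x + σ x y := by
    rw [← hd, ← List.isChain_reverse]
    simpa using h₃.imp fun x y h => ne_add_symm hσ h
  have hpath : ∀ x y, Consecutive (a :: p ++ [b]) x y → s(x, y) ≠ s(a, d) →
      c' y ≠ c' x + σ x y := by
    intro x y hxy hne
    rw [List.cons_append, hd, consecutive_cons_cons] at hxy
    rcases hxy with ⟨rfl, rfl⟩ | hxy
    · exact absurd rfl hne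
    · exact rel_of_consecutive hchain hxy
  have hstar : ∀ y, y = u ∨ y ∈ a :: p ++ [b] → c' y ≠ c' w + σ w y := by
    intro y hy
    simp only [List.cons_append, List.mem_cons, List.mem_append, List.not_mem_nil,
      or_false] at hy
    rw [hcw]
    rcases hy with rfl | rfl | hy | rfl
    · exact hcw ▸ ne_add_symm hσ (by rwa [hcw, hold _ hu])
    · exact hcw ▸ ne_add_symm hσ (by rwa [hcw, hold _ ha])
    · exact (h₂ y hy).2
    · exact hcw ▸ ne_add_symm hσ (by rwa [hcw, hold _ hb])
  refine ⟨c', hold, hcw, fun x hx => (h₂ x hx).1, fun x y hxy hne => ?_⟩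
  rcases insertWheel_adj.1 hxy with ⟨h, h'⟩ | ⟨-, h | h⟩ | ⟨-, ⟨rfl, h⟩ | ⟨rfl, h⟩⟩
  · rw [hold x (hG.adj_mem _ _ h), hold y (hG.adj_mem _ _ h.symm)]
    exact hc x y h h'
  · exact hpath x y h hne
  · exact ne_add_symm hσ (hpath y x h (by rwa [Sym2.eq_swap]))
  · exact hstar y h
  · exact ne_add_symm hσ (hstar x h)

/-- `c` is a coloring of `G` minus the edge `v₂b` that extends the precoloring `c₀` and respects
the forbidden colors. -/
structure IsPartialSolution (G : PlaneGraph V) (σ : V → V → ZMod 5) (v₁ v₂ b vk : V)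
    (c₀ : V → ZMod 5) (F : V → Finset (ZMod 5)) (c : V → ZMod 5) : Prop where
  eq₁ : c v₁ = c₀ v₁
  eq₂ : c v₂ = c₀ v₂
  eqk : c vk = c₀ vk
  coloring : G.IsColoringOff σ v₂ b c
  notMem : ∀ x ∈ G.outer, x ≠ v₁ → x ≠ v₂ → x ≠ vk → c x ∉ F x

/-- `w` is the hub of the wheel that was inserted last, next to the edge `v₂b`, and the colorings
of `G` minus `v₂b` give at least two colors to `w`. -/
structure IsApex (G : PlaneGraph V) (v₁ v₂ b vk w : V) : Prop where
  mem : w ∈ G.verts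
  notMem : w ∉ G.outer
  adj_left : G.graph.Adj w v₂
  adj_right : G.graph.Adj w b
  face : ∀ T ∈ G.faces, v₂ ∈ T → b ∈ T → T = {w, v₂, b}
  adj₂ : G.graph.Adj v₁ v₂
  adjk : G.graph.Adj v₁ vk
  exists_two : ∀ (σ : V → V → ZMod 5) (c₀ : V → ZMod 5) (F : V → Finset (ZMod 5)),
    (∀ x y, σ y x = -σ x y) → c₀ v₂ ≠ c₀ v₁ + σ v₁ v₂ → c₀ vk ≠ c₀ v₁ + σ v₁ vk →
    (∀ x ∈ G.outer, x ≠ v₁ → x ≠ v₂ → x ≠ vk → (F x).card ≤ 2) →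
    ∃ c c', G.IsPartialSolution σ v₁ v₂ b vk c₀ F c ∧ G.IsPartialSolution σ v₁ v₂ b vk c₀ F c' ∧
      c w ≠ c' w

theorem exists_two_colors (x y z : ZMod 5) :
    ∃ γ δ : ZMod 5, γ ≠ δ ∧ (γ ≠ x ∧ γ ≠ y ∧ γ ≠ z) ∧ δ ≠ x ∧ δ ≠ y ∧ δ ≠ z := by
  obtain ⟨γ, h₁, h₂, h₃⟩ := exists_fan_color (S := {x}) (by simp) y z
  obtain ⟨δ, g₁, g₂, g₃⟩ := exists_fan_color (S := {x, y}) Finset.card_le_two z γ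
  simp only [Finset.mem_singleton, Finset.mem_insert, not_or] at h₁ g₁
  exact ⟨γ, δ, g₃.symm, ⟨h₁, h₂, h₃⟩, g₁.1, g₁.2, g₂⟩

/-- The hub must respect the precolored `v₁`, `v₂`, `vk`, which leaves two colors. With `v₂b`
omitted, the rest of the rim is a fan starting at `vk` and ending at `b`, colored greedily. -/
theorem isApex_wheel {h v₁ v₂ b vk : V} {t : List V}
    (hnodup : (h :: v₁ :: v₂ :: b :: t).Nodup) (hk : (b :: t).getLast? = some vk) :
    (wheel h (v₁ :: v₂ :: b :: t)).IsApex v₁ v₂ b vk h := by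
  obtain ⟨s, hs⟩ := List.getLast?_eq_some_iff.1 hk
  have hcyc : ∀ x y, Consecutive (v₁ :: v₂ :: b :: t ++ List.take 1 (v₁ :: v₂ :: b :: t)) x y ↔
      (x = v₁ ∧ y = v₂) ∨ (x = v₂ ∧ y = b) ∨ Consecutive (b :: t ++ [v₁]) x y := by
    intro x y
    simp only [List.take_succ_cons, List.take_zero, List.cons_append, consecutive_cons_cons]
  have hlast : Consecutive (b :: t ++ [v₁]) vk v₁ := by
    rw [hs]; exact ⟨s, [], by simp⟩
  have hnd := hnodup
  simp only [List.nodup_cons, List.mem_cons, not_or] at hnd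
  obtain ⟨⟨hh₁, hh₂, hhb, hht⟩, ⟨h₁₂, h₁b, h₁t⟩, ⟨h₂b, h₂t⟩, hbt, htn⟩ := hnd
  have hvk : vk ∈ b :: t := by rw [hs]; simp
  have h₁k : v₁ ≠ vk := by
    rintro rfl; simp only [List.mem_cons] at hvk; tauto
  have hhk : h ≠ vk := by
    rintro rfl; simp only [List.mem_cons] at hvk; tauto
  have h₂k : v₂ ≠ vk := by
    rintro rfl; simp only [List.mem_cons] at hvk; tauto
  refine ⟨Or.inl rfl, (List.nodup_cons.1 hnodup).1, ?_, ?_, ?_, ?_, ?_, ?_⟩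
  · exact wheel_adj.2 (Or.inr ⟨hh₂, Or.inl ⟨rfl, by simp⟩⟩)
  · exact wheel_adj.2 (Or.inr ⟨hhb, Or.inl ⟨rfl, by simp⟩⟩)
  · rintro T ⟨x, y, hxy, rfl⟩ h₂ hb
    have h₂' : v₂ = x ∨ v₂ = y := by
      rcases h₂ with h | h | h
      · exact absurd h.symm hh₂
      · exact Or.inl h
      · exact Or.inr h
    rcases (hcyc x y).1 hxy with ⟨rfl, rfl⟩ | ⟨rfl, rfl⟩ | hc
    · exfalso
      rcases hb with h | h | h
      · exact hhb h.symm
      · exact h₁b h.symm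
      · exact h₂b h.symm
    · rfl
    · exfalso
      have hmem : v₂ ∈ b :: t ++ [v₁] := by
        rcases h₂' with rfl | rfl
        exacts [hc.mem.1, hc.mem.2]
      simp only [List.cons_append, List.mem_cons, List.mem_append, List.not_mem_nil,
        or_false] at hmem
      rcases hmem with h | h | h
      exacts [h₂b h, h₂t h, h₁₂ h.symm]
  · exact wheel_adj.2 (Or.inl ⟨h₁₂, Or.inl ((hcyc _ _).2 (Or.inl ⟨rfl, rfl⟩))⟩)
  · exact wheel_adj.2 (Or.inl ⟨h₁k, Or.inr ((hcyc _ _).2 (Or.inr (Or.inr hlast)))⟩)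
  · intro σ c₀ F hσ h₂ hk' hF
    classical
    have key : ∀ γ, γ ≠ c₀ v₁ + σ v₁ h → γ ≠ c₀ v₂ + σ v₂ h → γ ≠ c₀ vk + σ vk h →
        ∃ c, (wheel h (v₁ :: v₂ :: b :: t)).IsPartialSolution σ v₁ v₂ b vk c₀ F c ∧ c h = γ := by
      intro γ hγ₁ hγ₂ hγk
      have hsub : ∀ x ∈ s, x ∈ b :: t := fun x hx => by rw [hs]; simp [hx]
      have hbtn : (s ++ [vk]).Nodup := by rw [← hs]; exact List.nodup_cons.2 ⟨hbt, htn⟩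
      have hsk : ∀ x ∈ s, x ≠ vk := fun x hx hxk => by
        rw [hxk] at hx
        exact (List.nodup_append'.1 hbtn).2.2 hx (by simp)
      have hsn : ∀ x ∈ s, x ≠ h ∧ x ≠ v₁ ∧ x ≠ v₂ := by
        intro x hx
        have := hsub x hx
        simp only [List.mem_cons] at this
        refine ⟨?_, ?_, ?_⟩ <;> rintro rfl <;> tauto
      have hfan : FanGood σ F h γ vk (c₀ vk) s.reverse := fanGood_of_card_le (fun x hx => by
        rw [List.mem_reverse] at hx
        refine hF x ?_ (hsn x hx).2.1 (hsn x hx).2.2 (hsk x hx)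
        exact List.mem_cons_of_mem _ (List.mem_cons_of_mem _ (hsub x hx))) _ _
      obtain ⟨c, g₁, g₂, g₃⟩ := exists_coloring_of_fanGood (q := s.reverse) (b := vk)
        (c := Function.update c₀ h γ) (by
          rw [List.nodup_cons, List.mem_reverse, List.nodup_reverse]
          exact ⟨fun hx => hsk _ hx rfl, (List.nodup_append'.1 hbtn).1⟩)
        (by simpa [hhk.symm] using hfan)
      simp only [List.mem_reverse] at g₁ g₂
      have e₁ : c v₁ = c₀ v₁ := by
        rw [g₁ v₁ fun hx => (hsn _ hx).2.1 rfl]; simp [Ne.symm hh₁]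
      have e₂ : c v₂ = c₀ v₂ := by
        rw [g₁ v₂ fun hx => (hsn _ hx).2.2 rfl]; simp [Ne.symm hh₂]
      have ek : c vk = c₀ vk := by
        rw [g₁ vk fun hx => hsk _ hx rfl]; simp [hhk.symm]
      have eh : c h = γ := by
        rw [g₁ h fun hx => (hsn _ hx).1 rfl]; simp
      have hchain : (b :: t ++ [v₁]).IsChain fun x y => c y ≠ c x + σ x y := by
        have g₄ : (v₁ :: vk :: s.reverse).IsChain fun x y => c y ≠ c x + σ x y := by
          rw [List.isChain_cons_cons]
          exact ⟨by rw [e₁, ek]; exact hk', g₃⟩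
        rw [hs, ← List.isChain_reverse]
        simpa using g₄.imp fun x y h => ne_add_symm hσ h
      have hpath : ∀ x y, Consecutive (v₁ :: v₂ :: b :: t ++ List.take 1 (v₁ :: v₂ :: b :: t)) x y →
          s(x, y) ≠ s(v₂, b) → c y ≠ c x + σ x y := by
        intro x y hxy hne
        rcases (hcyc x y).1 hxy with ⟨rfl, rfl⟩ | ⟨rfl, rfl⟩ | hc
        · rw [e₁, e₂]; exact h₂
        · exact absurd rfl hne
        · exact rel_of_consecutive hchain hc
      have hstar : ∀ y ∈ v₁ :: v₂ :: b :: t, c y ≠ c h + σ h y := by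
        intro y hy
        rw [hs] at hy
        simp only [List.mem_cons, List.mem_append, List.not_mem_nil, or_false] at hy
        rcases hy with rfl | rfl | hy | rfl
        · exact ne_add_symm hσ (by rwa [eh, e₁])
        · exact ne_add_symm hσ (by rwa [eh, e₂])
        · rw [eh]; exact (g₂ y hy).2
        · exact ne_add_symm hσ (by rwa [eh, ek])
      refine ⟨c, ⟨e₁, e₂, ek, fun x y hxy hne => ?_, fun x hx hx₁ hx₂ hxk => ?_⟩, eh⟩
      · rcases wheel_adj.1 hxy with ⟨-, h | h⟩ | ⟨-, ⟨rfl, h⟩ | ⟨rfl, h⟩⟩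
        · exact hpath x y h hne
        · exact ne_add_symm hσ (hpath y x h (by rwa [Sym2.eq_swap]))
        · exact hstar y h
        · exact ne_add_symm hσ (hstar x h)
      · change x ∈ v₁ :: v₂ :: b :: t at hx
        rw [hs] at hx
        simp only [List.mem_cons, List.mem_append, List.not_mem_nil, or_false] at hx
        rcases hx with hx | hx | hx | hx
        exacts [absurd hx hx₁, absurd hx hx₂, (g₂ x hx).1, absurd hx hxk]
    obtain ⟨γ, δ, hγδ, ⟨a₁, a₂, a₃⟩, d₁, d₂, d₃⟩ :=
      exists_two_colors (c₀ v₁ + σ v₁ h) (c₀ v₂ + σ v₂ h) (c₀ vk + σ vk h)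
    obtain ⟨c, hc, hcγ⟩ := key γ a₁ a₂ a₃
    obtain ⟨c', hc', hcδ⟩ := key δ d₁ d₂ d₃
    exact ⟨c, c', hc, hc', by rwa [hcγ, hcδ]⟩

end PlaneGraph

/-! ### Induction along the stack of wheels and the last wheel. -/

namespace PlaneGraph

variable {V : Type*}

/-- Forces the next wheel inserted at `v₂b` to attach to the current apex. -/
theorem IsApex.eq_of_face {G : PlaneGraph V} {v₁ v₂ b vk w u : V} (hw : G.IsApex v₁ v₂ b vk w)
    (hface : {v₂, b, u} ∈ G.faces) (hu₂ : u ≠ v₂) (hub : u ≠ b) : u = w := by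
  have h : u ∈ ({w, v₂, b} : Set V) := by
    rw [← hw.face _ hface (by simp) (by simp)]; simp
  rcases h with h | h | h
  exacts [h, absurd h hu₂, absurd h hub]

theorem IsPartialSolution.exists_extension {G : PlaneGraph V} (hG : G.IsProper) {r : List V}
    {v₁ v₂ b vk u w : V} {p : List V} (houter : G.outer = v₁ :: v₂ :: b :: r)
    (hvk : vk ∈ G.outer) (hu : u ∈ G.verts)
    (hnew : ∀ x ∈ w :: p, x ∉ G.verts) (hnodup : (w :: p).Nodup)
    {σ : V → V → ZMod 5} (hσ : ∀ x y, σ y x = -σ x y) {F : V → Finset (ZMod 5)}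
    {c₀ c : V → ZMod 5} (hc : G.IsPartialSolution σ v₁ v₂ b vk c₀ F c) {γ : ZMod 5}
    (hγ₂ : γ ≠ c₀ v₂ + σ v₂ w) (hγu : γ ≠ c u + σ u w) (hγb : γ ≠ c b + σ b w)
    (hfan : FanGood σ F w γ b (c b) p.reverse) {d : V} {t : List V} (hd : p ++ [b] = d :: t) :
    ∃ c', (G.insertWheel [v₁] r v₂ b u w p).IsPartialSolution σ v₁ v₂ d vk c₀ F c' ∧
      c' w = γ := by
  obtain ⟨c', h₁, h₂, h₃, h₄⟩ := hG.exists_extension (l := [v₁]) (by simpa using houter) hu hnew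
    hnodup hσ hc.coloring (by rwa [hc.eq₂]) hγu hγb hfan hd
  refine ⟨c', ⟨?_, ?_, ?_, h₄, fun x hx hx₁ hx₂ hxk => ?_⟩, h₂⟩
  · rw [h₁ _ (hG.outer_mem _ (by simp [houter])), hc.eq₁]
  · rw [h₁ _ (hG.outer_mem _ (by simp [houter])), hc.eq₂]
  · rw [h₁ _ (hG.outer_mem _ hvk), hc.eqk]
  · by_cases hxp : x ∈ p
    · exact h₃ x hxp
    · have hxo : x ∈ G.outer := by
        simp only [insertWheel, List.mem_append, List.mem_cons, List.not_mem_nil, or_false] at hx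
        simp only [houter, List.mem_cons]
        tauto
      rw [h₁ x (hG.outer_mem x hxo)]
      exact hc.notMem x hxo hx₁ hx₂ hxk

/-- One coloring of the old graph suffices: the new hub avoids only the colors coming from `v₂`, `u`
and `b`, and either remaining choice extends greedily over `p`. The case `p = []`, where `d = b`, is
included, so separating triangles do no harm here. -/
theorem IsApex.insertWheel {G : PlaneGraph V} (hG : G.IsProper) {r : List V}
    {v₁ v₂ b vk u w : V} {p : List V} (hA : G.IsApex v₁ v₂ b vk u)
    (houter : G.outer = v₁ :: v₂ :: b :: r) (hvk : vk ∈ G.outer)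
    (hnew : ∀ x ∈ w :: p, x ∉ G.verts) (hnodup : (w :: p).Nodup)
    {d : V} {t : List V} (hd : p ++ [b] = d :: t) :
    (G.insertWheel [v₁] r v₂ b u w p).IsApex v₁ v₂ d vk w := by
  have hmem := hG.outer_mem
  rw [houter] at hmem
  have h₁ := hmem v₁ (by simp)
  have h₂ := hmem v₂ (by simp)
  have hb := hmem b (by simp)
  have hw : w ∉ G.verts := hnew w (by simp)
  have hwp := (List.nodup_cons.1 hnodup).1
  have hne : ∀ x ∈ G.verts, x ≠ w := fun x hx h => hw (h ▸ hx)
  have hp : ∀ x ∈ G.verts, x ∉ p := fun x hx hxp => hnew x (by simp [hxp]) hx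
  have hd' : d ∈ p ∨ d = b := by
    have : d ∈ p ++ [b] := by simp [hd]
    simpa using this
  have hwd : w ≠ d := by
    rcases hd' with h | h
    · rintro rfl; exact hwp h
    · exact h ▸ (hne b hb).symm
  have hnd := hG.nodup
  rw [houter] at hnd
  simp only [List.nodup_cons, List.mem_cons, not_or] at hnd
  obtain ⟨⟨h₁₂, h₁b, -⟩, ⟨h₂b, -⟩, -⟩ := hnd
  have hu₂ : u ≠ v₂ := hA.adj_left.ne
  have hub : u ≠ b := hA.adj_right.ne
  refine ⟨Or.inr (Or.inl rfl), fun h => ?_, ?_, ?_, ?_, ?_, ?_, ?_⟩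
  · have hwo : w ∉ v₁ :: v₂ :: b :: r := fun h => hw (hmem w h)
    simp only [List.mem_cons, not_or] at hwo
    simp only [PlaneGraph.insertWheel, List.mem_append, List.mem_cons, List.not_mem_nil,
      or_false] at h
    tauto
  · exact insertWheel_adj.2 (Or.inr (Or.inr ⟨(hne v₂ h₂).symm, Or.inl ⟨rfl, by simp⟩⟩))
  · exact insertWheel_adj.2 (Or.inr (Or.inr ⟨hwd, Or.inl ⟨rfl, by simp [hd]⟩⟩))
  · rintro T (⟨⟨hT, hT'⟩ | (rfl | rfl)⟩ | ⟨x, y, hxy, rfl⟩) hT₂ hTd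
    · exfalso
      rcases hd' with h | rfl
      · exact hp d (hG.face_mem T hT d hTd) h
      -- Here `d` is the old `b`; the only old face at that edge is the triangle removed by the
      -- insertion.
      · apply hT'
        rw [Set.mem_singleton_iff, hA.face T hT hT₂ hTd, Set.insert_comm, Set.pair_comm]
    · exfalso
      rcases hTd with h | h | h
      · exact hwd h.symm
      · rcases hd' with h' | h'
        · exact hp u hA.mem (h ▸ h')
        · exact hub (h.symm.trans h')
      · rw [Set.mem_singleton_iff] at h
        rcases hd' with h' | h'
        · exact hp v₂ h₂ (h ▸ h')
        · exact h₂b (h.symm.trans h')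
    · exfalso
      rcases hT₂ with h | h | h
      exacts [hne _ h₂ h, hu₂ h.symm, h₂b h]
    · rw [List.cons_append, hd, consecutive_cons_cons] at hxy
      rcases hxy with ⟨rfl, rfl⟩ | hxy
      · rfl
      · exfalso
        have hmem₂ : v₂ ∈ p ++ [b] := by
          rw [hd]
          rcases hT₂ with h | h | h
          · exact absurd h (hne _ h₂)
          · exact h ▸ hxy.mem.1
          · rw [Set.mem_singleton_iff] at h
            exact h ▸ hxy.mem.2
        rcases List.mem_append.1 hmem₂ with h | h
        · exact hp _ h₂ h
        · exact h₂b (List.mem_singleton.1 h)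
  · exact insertWheel_adj.2 (Or.inl ⟨hA.adj₂, by simp [h₁₂, h₁b]⟩)
  · exact insertWheel_adj.2 (Or.inl ⟨hA.adjk, by simp [h₁₂, h₁b]⟩)
  · intro σ c₀ F hσ hc₂ hck hF
    obtain ⟨c, -, hc, -⟩ := hA.exists_two σ c₀ F hσ hc₂ hck fun x hx => hF x (by
      simp only [houter, List.mem_cons] at hx
      simp only [PlaneGraph.insertWheel, List.mem_append, List.mem_cons, List.not_mem_nil,
        or_false]
      tauto)
    have hfan : ∀ γ, FanGood σ F w γ b (c b) p.reverse := fun γ =>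
      fanGood_of_card_le (fun x hx => by
        rw [List.mem_reverse] at hx
        refine hF x (by simp [PlaneGraph.insertWheel, hx]) ?_ ?_ ?_
        · rintro rfl; exact hp _ h₁ hx
        · rintro rfl; exact hp _ h₂ hx
        · rintro rfl; exact hp _ (hG.outer_mem _ hvk) hx) _ _
    obtain ⟨γ, δ, hγδ, ⟨a₁, a₂, a₃⟩, d₁, d₂, d₃⟩ :=
      exists_two_colors (c₀ v₂ + σ v₂ w) (c u + σ u w) (c b + σ b w)
    obtain ⟨c₁, g₁, e₁⟩ := hc.exists_extension hG houter hvk hA.mem hnew hnodup hσ a₁ a₂ a₃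
      (hfan γ) hd
    obtain ⟨c₂, g₂, e₂⟩ := hc.exists_extension hG houter hvk hA.mem hnew hnodup hσ d₁ d₂ d₃
      (hfan δ) hd
    exact ⟨c₁, c₂, g₁, g₂, by rwa [e₁, e₂]⟩

theorem getLast?_append_cons_eq {p r : List V} {b vk : V}
    (h : (p ++ b :: r).getLast? = some vk) : (b :: r).getLast? = some vk := by
  rwa [List.getLast?_append_cons] at h

theorem IsMultiWheel.exists_isApex {G : PlaneGraph V} (hG : G.IsMultiWheel) {v₁ v₂ b vk : V}
    {t : List V} (hout : G.outer = v₁ :: v₂ :: b :: t) (hk : (b :: t).getLast? = some vk)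
    (hv₂ : ∀ x ∈ G.inner, G.graph.Adj x v₂) : ∃ w, G.IsApex v₁ v₂ b vk w := by
  induction hG generalizing b t with
  | wheel h C hlen hnodup =>
    change C = _ at hout
    subst hout
    exact ⟨h, isApex_wheel hnodup hk⟩
  | insert G l r a b' u w p hG houter hl hu hu' hface hnew hnodup ih =>
    have hP := hG.isProper
    obtain ⟨rfl, rfl, ht, hout', hv₂'⟩ :=
      hP.eq_of_insertWheel houter hl hu' hnew hnodup hout hv₂
    rw [ht] at hk
    have hk' := getLast?_append_cons_eq hk
    obtain ⟨w₀, hA⟩ := ih hout' hk' hv₂'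
    have hw₀ := hA.eq_of_face hface (fun h => hu' (by simp [hout', h]))
      (fun h => hu' (by simp [hout', h]))
    subst hw₀
    obtain ⟨d, t', hd⟩ : ∃ d t', p ++ [b'] = d :: t' :=
      List.exists_cons_of_ne_nil (by simp)
    have hbd : b = d := by
      have : p ++ b' :: r = (d :: t') ++ r := by rw [← hd]; simp
      rw [← ht] at this
      exact (List.cons.inj this).1
    subst hbd
    have hvk : vk ∈ G.outer := by
      rw [hout']
      exact List.mem_cons_of_mem _ (List.mem_cons_of_mem _ (List.mem_of_getLast? hk'))
    exact ⟨w, hA.insertWheel hP hout' hvk hnew hnodup hd⟩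

/-- A wheel without new outer vertices creates a separating triangle. -/
theorem IsApex.hasSeparatingTriangle {G : PlaneGraph V} (hG : G.IsProper) {r : List V}
    {v₁ v₂ b vk u w : V} (hA : G.IsApex v₁ v₂ b vk u)
    (houter : G.outer = v₁ :: v₂ :: b :: r) (hu' : u ∉ G.outer) (hw : w ∉ G.verts) :
    (G.insertWheel [v₁] r v₂ b u w []).HasSeparatingTriangle := by
  have hmem := hG.outer_mem
  rw [houter] at hmem hu'
  have h₁ := hmem v₁ (by simp)
  have h₂ := hmem v₂ (by simp)
  have hb := hmem b (by simp)
  have hnd := hG.nodup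
  rw [houter] at hnd
  simp only [List.nodup_cons, List.mem_cons, not_or] at hnd hu'
  obtain ⟨⟨h₁₂, h₁b, -⟩, ⟨h₂b, -⟩, -⟩ := hnd
  have hne : ∀ x ∈ G.verts, x ≠ w := fun x hx h => hw (h ▸ hx)
  refine ⟨v₂, b, u, ?_, ?_, ?_, fun hcon => ?_⟩
  · exact insertWheel_adj.2 (Or.inr (Or.inl ⟨h₂b, Or.inl (List.infix_refl _)⟩))
  · exact insertWheel_adj.2 (Or.inl ⟨hA.adj_right.symm, by simp [hu'.2.1, hu'.2.2.1]⟩)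
  · exact insertWheel_adj.2 (Or.inl ⟨hA.adj_left.symm, by simp [hu'.2.2.1, h₂b]⟩)
  -- The triangle separates `w` from `v₁`: every neighbor of `w` lies on it, so a walk to `v₁` has
  -- no first step.
  · let x : ↥((G.insertWheel [v₁] r v₂ b u w []).verts \ {v₂, b, u}) :=
      ⟨w, Or.inr (Or.inl rfl), by
        simp [(hne _ h₂).symm, (hne _ hb).symm, (hne _ hA.mem).symm]⟩
    let y : ↥((G.insertWheel [v₁] r v₂ b u w []).verts \ {v₂, b, u}) :=
      ⟨v₁, Or.inl h₁, by simp [h₁₂, h₁b, Ne.symm hu'.1]⟩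
    have hxy : x ≠ y := fun h => hne _ h₁ (congrArg Subtype.val h).symm
    obtain ⟨q⟩ := hcon x y
    have hz' := q.adj_snd (SimpleGraph.Walk.not_nil_of_ne hxy)
    obtain ⟨z, hzn, hz⟩ : ∃ z, z ∉ ({v₂, b, u} : Set V) ∧
        (G.insertWheel [v₁] r v₂ b u w []).graph.Adj w z := ⟨_, q.snd.2.2, hz'⟩
    simp only [Set.mem_insert_iff, Set.mem_singleton_iff, not_or] at hzn
    rcases insertWheel_adj.1 hz with ⟨h, -⟩ | ⟨-, h | h⟩ | ⟨h', ⟨-, h⟩ | ⟨h, -⟩⟩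
    · exact hw (hG.adj_mem _ _ h)
    · have := h.mem.2
      simp [hzn.1, hzn.2.1] at this
    · have := h.mem.1
      simp [hzn.1, hzn.2.1] at this
    · simp [hzn.1, hzn.2.1, hzn.2.2] at h
    · exact h' h.symm

/-- Colorings extend if the last wheel has a new outer vertex. -/
theorem IsApex.exists_coloring {G : PlaneGraph V} (hG : G.IsProper) {r : List V}
    {v₁ v₂ b vk u w d : V} {p : List V} (hA : G.IsApex v₁ v₂ b vk u)
    (houter : G.outer = v₁ :: v₂ :: b :: r) (hvk : vk ∈ G.outer)
    (hnew : ∀ x ∈ w :: d :: p, x ∉ G.verts) (hnodup : (w :: d :: p).Nodup)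
    {σ : V → V → ZMod 5} {c₀ : V → ZMod 5} {F : V → Finset (ZMod 5)}
    (hσ : ∀ x y, σ y x = -σ x y) (hc₂ : c₀ v₂ ≠ c₀ v₁ + σ v₁ v₂)
    (hck : c₀ vk ≠ c₀ v₁ + σ v₁ vk)
    (hF : ∀ x ∈ (G.insertWheel [v₁] r v₂ b u w (d :: p)).outer,
      x ≠ v₁ → x ≠ v₂ → x ≠ vk → (F x).card ≤ 2) :
    ∃ c : V → ZMod 5, c v₁ = c₀ v₁ ∧ c v₂ = c₀ v₂ ∧ c vk = c₀ vk ∧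
      (∀ x y, (G.insertWheel [v₁] r v₂ b u w (d :: p)).graph.Adj x y → c y ≠ c x + σ x y) ∧
      ∀ x ∈ (G.insertWheel [v₁] r v₂ b u w (d :: p)).outer,
        x ≠ v₁ → x ≠ v₂ → x ≠ vk → c x ∉ F x := by
  classical
  have hp : ∀ x ∈ G.outer, x ∉ d :: p := fun x hx hxp =>
    hnew x (List.mem_cons_of_mem _ hxp) (hG.outer_mem x hx)
  have hnodup' := (List.nodup_cons.1 hnodup).2
  have hne : ∀ x ∈ d :: p, x ≠ v₁ ∧ x ≠ v₂ ∧ x ≠ vk := by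
    refine fun x hx => ⟨?_, ?_, ?_⟩ <;> rintro rfl
    exacts [hp _ (by simp [houter]) hx, hp _ (by simp [houter]) hx, hp _ hvk hx]
  have hFp : ∀ x ∈ d :: p, (F x).card ≤ 2 := fun x hx =>
    hF x (by simp only [PlaneGraph.insertWheel, List.mem_append, List.mem_cons] at hx ⊢; tauto)
      (hne x hx).1 (hne x hx).2.1 (hne x hx).2.2
  -- The edge `v₂d`, not checked by partial solutions, is encoded as one more forbidden color at
  -- `d`.
  let F' := Function.update F d (insert (c₀ v₂ + σ v₂ d) (F d))
  have hF'd : F' d = insert (c₀ v₂ + σ v₂ d) (F d) := Function.update_self ..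
  have hF' : ∀ x, x ≠ d → F' x = F x := fun x hx => Function.update_of_ne hx ..
  obtain ⟨c, c', hc, hc', hcc⟩ := hA.exists_two σ c₀ F' hσ hc₂ hck fun x hx h₁ h₂ hk => by
    rw [hF' x fun h => hp x hx (by simp [h])]
    refine hF x ?_ h₁ h₂ hk
    simp only [houter, List.mem_cons] at hx
    simp only [PlaneGraph.insertWheel, List.mem_append, List.mem_cons, List.not_mem_nil, or_false]
    tauto
  have hcard : ∀ x ∈ p.reverse, (F' x).card ≤ 2 := by
    intro x hx
    rw [List.mem_reverse] at hx
    rw [hF' x fun h => (List.nodup_cons.1 hnodup').1 (h ▸ hx)]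
    exact hFp x (by simp [hx])
  have hcardd : (F' d).card ≤ 3 := by
    rw [hF'd]
    have := hFp d (by simp)
    have := Finset.card_insert_le (c₀ v₂ + σ v₂ d) (F d)
    omega
  obtain ⟨c₁, h⟩ : ∃ c₁, (G.insertWheel [v₁] r v₂ b u w (d :: p)).IsPartialSolution
      σ v₁ v₂ d vk c₀ F' c₁ := by
    have hne : c u + σ u w ≠ c' u + σ u w := fun h => hcc (add_right_cancel h)
    rcases exists_fanGood (σ := σ) (w := w) (b := b) (x := c₀ v₂ + σ v₂ w) (s := σ b w)
      (β := c b) (β' := c' b) hcard hcardd hne with ⟨γ, a₁, a₂, a₃, a₄⟩ | ⟨γ, a₁, a₂, a₃, a₄⟩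
    · obtain ⟨c₁, h, -⟩ := hc.exists_extension hG houter hvk hA.mem hnew hnodup hσ a₁ a₂ a₃
        (by simpa using a₄) (List.cons_append ..)
      exact ⟨c₁, h⟩
    · obtain ⟨c₁, h, -⟩ := hc'.exists_extension hG houter hvk hA.mem hnew hnodup hσ a₁ a₂ a₃
        (by simpa using a₄) (List.cons_append ..)
      exact ⟨c₁, h⟩
  have hd := h.notMem d (by simp [PlaneGraph.insertWheel]) (hne d (by simp)).1
    (hne d (by simp)).2.1 (hne d (by simp)).2.2
  simp only [hF'd, Finset.mem_insert, not_or] at hd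
  refine ⟨c₁, h.eq₁, h.eq₂, h.eqk, fun x y hxy => ?_, fun x hx h₁ h₂ hk => ?_⟩
  · by_cases hs : s(x, y) = s(v₂, d)
    · have hd₁ : c₁ d ≠ c₁ v₂ + σ v₂ d := by rw [h.eq₂]; exact hd.1
      rcases Sym2.eq_iff.1 hs with ⟨rfl, rfl⟩ | ⟨rfl, rfl⟩
      · exact hd₁
      · exact ne_add_symm hσ hd₁
    · exact h.coloring x y hxy hs
  · by_cases hxd : x = d
    · subst hxd; exact hd.2
    · have := h.notMem x hx h₁ h₂ hk
      rwa [hF' x hxd] at this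

end PlaneGraph

/-! ### From oriented edges to antisymmetric shifts, and the theorem. -/

open Classical in
/-- The shift along a pair of vertices: `φ` with the sign given by the orientation. -/
noncomputable def EdgeOrientation.shift {V : Type*} {G : SimpleGraph V} (D : EdgeOrientation G)
    (φ : Sym2 V → ZMod 5) (x y : V) : ZMod 5 :=
  if D.dir x y then φ s(x, y) else if D.dir y x then -φ s(x, y) else 0

theorem EdgeOrientation.shift_swap {V : Type*} {G : SimpleGraph V} (D : EdgeOrientation G)
    (φ : Sym2 V → ZMod 5) (x y : V) : D.shift φ y x = -D.shift φ x y := by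
  have h := D.asymm x y
  unfold EdgeOrientation.shift
  rw [Sym2.eq_swap]
  by_cases h₁ : D.dir x y
  · simp [h₁, h h₁]
  · by_cases h₂ : D.dir y x <;> simp [h₁, h₂]

/-- Adjacency matters: off the edges `shift` is `0`, whereas `tau` still subtracts `φ`. -/
theorem tau_eq_add_shift {V : Type*} {G : SimpleGraph V} (D : EdgeOrientation G)
    (φ : Sym2 V → ZMod 5) {x y : V} (hxy : G.Adj x y) (α : ZMod 5) :
    tau D φ x α y = α + D.shift φ x y := by
  unfold tau EdgeOrientation.shift
  by_cases h : D.dir x y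
  · simp [h]
  · simp [h, (D.dir_or_dir x y hxy).resolve_left h, sub_eq_add_neg]

theorem corollary1 {V : Type*} (G : PlaneGraph V) (hG : G.IsMultiWheel)
    (hsep : ¬ G.HasSeparatingTriangle)
    (hinner : 2 ≤ G.inner.encard)
    (v₁ v₂ vk : V) (m : List V) (houter : G.outer = [v₁, v₂] ++ m ++ [vk])
    (hv₂ : ∀ u ∈ G.inner, G.graph.Adj u v₂)
    (D : EdgeOrientation G.graph) (φ : Sym2 V → ZMod 5) :
    G.IsThreeExtendable D φ v₁ v₂ vk := by
  intro c₀ F hk h₂ hF _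
  have hout : G.outer = v₁ :: v₂ :: (m ++ [vk]) := by simpa using houter
  cases hG with
  | wheel h C hlen hnodup =>
    exfalso
    have hsub : (PlaneGraph.wheel h C).inner ⊆ {h} := fun x hx => hx.1.resolve_right hx.2
    have hle := (Set.encard_le_encard hsub).trans (Set.encard_singleton h).le
    exact absurd (hinner.trans hle) (by norm_num)
  | insert G l r a b u w p hG hout₀ hl hu hu' hface hnew hnodup =>
    have hP := hG.isProper
    obtain ⟨rfl, rfl, ht, hout', hv₂'⟩ :=
      hP.eq_of_insertWheel hout₀ hl hu' hnew hnodup hout hv₂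
    have hlast : (b :: r).getLast? = some vk :=
      PlaneGraph.getLast?_append_cons_eq (p := p) (by rw [← ht]; simp)
    obtain ⟨w₀, hA⟩ := hG.exists_isApex hout' hlast hv₂'
    have hw₀ := hA.eq_of_face hface (fun h => hu' (by simp [hout', h]))
      (fun h => hu' (by simp [hout', h]))
    subst hw₀
    have hvk : vk ∈ G.outer := by
      rw [hout']
      exact List.mem_cons_of_mem _ (List.mem_cons_of_mem _ (List.mem_of_getLast? hlast))
    cases p with
    | nil => exact absurd (hA.hasSeparatingTriangle hP hout' hu' (hnew w (by simp))) hsep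
    | cons d p =>
      -- Used only for the adjacencies of `v₁` to `v₂` and `vk` in the whole graph; the coloring
      -- comes from `hA`.
      have hA' := hA.insertWheel hP hout' hvk hnew hnodup (List.cons_append ..)
      rw [tau_eq_add_shift D φ hA'.adjk] at hk
      rw [tau_eq_add_shift D φ hA'.adj₂] at h₂
      obtain ⟨c, e₁, e₂, ek, hc, hcF⟩ := hA.exists_coloring hP hout' hvk hnew hnodup
        (D.shift_swap φ) h₂ hk hF
      refine ⟨c, e₁, e₂, ek, fun x y hxy h => hc x y (D.adj_of_dir x y hxy) ?_, hcF⟩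
      rw [← tau_eq_add_shift D φ (D.adj_of_dir x y hxy), tau, if_pos hxy, ← h]
      ring
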